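/- Let $d(s,t)$ be an arbitrary bivariate function on $n$ objects (no symmetry, triangle inequality or numerical values are assumed) with values in a linearly ordered set. Greedy matching starts from all $n$ objects and, as long as at least two objects remain, selects an ordered pair $(s,t)$ of distinct remaining objects for which $d(s,t)$ is minimum among all such pairs (in the minimum-weight version) or maximum among all such pairs (in the maximum-weight version), with ties broken arbitrarily, and removes both objects. The model of computation is a random access machine with words of $O(\log n)$ bits and unit-cost arithmetic on words, on which the objects are accessed by their numbers $0,\dots,n-1$, and on which evaluating the distance of two objects and comparing two distances take constant time each. Time is the worst-case number of operations, and space is the number of memory words; the output is written to a separate write-only output. **Theorem.** For each of the two versions (closest pairs, farthest pairs): 1. there is a program that, for every $n$ and every $d$, outputs the sequence of pairs selected in some run of greedy matching, in the order of selection, in time $O(n^2\log^2 n)$ and space $O(n)$; 2. there is a program that, for every $n$ and every $d$, outputs such a sequence in time $O(n^2)$. The programs and the constants in the $O$-bounds depend neither on $n$ nor on $d$. -/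

import Mathlib

/-! Greedy matchings, and a random access machine with a distance oracle. -/

universe u

/-- The two versions of greedy matching: select the closest pair (for a minimum-weight matching) or
the farthest pair (for a maximum-weight matching). -/
inductive Objective where
  | closest
  | farthest

/-- `o.Prefers a b`: a pair at distance `a` may be selected in preference to one at distance `b`. -/
def Objective.Prefers {D : Type*} [LinearOrder D] : Objective → D → D → Prop
  | .closest, a, b => a ≤ b
  | .farthest, a, b => b ≤ a

/-- `IsGreedyMatching o d R M`: the list `M` is a possible sequence of selections of the greedy
matching procedure started on the set `R` of points. As long as two points remain, a pair `(s, t)` of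
distinct remaining points whose distance `d s t` is optimal (ties are broken arbitrarily) is
selected and both points are removed. Nothing is assumed about `d`, not even symmetry. -/
inductive IsGreedyMatching {X : Type*} [DecidableEq X] {D : Type*} [LinearOrder D]
    (o : Objective) (d : X → X → D) : Finset X → List (X × X) → Prop
  | done (R : Finset X) (hR : R.card ≤ 1) : IsGreedyMatching o d R []
  | select (R : Finset X) (s t : X) (M : List (X × X)) (hs : s ∈ R) (ht : t ∈ R) (hst : s ≠ t)
      (hopt : ∀ s' ∈ R, ∀ t' ∈ R, s' ≠ t' → o.Prefers (d s t) (d s' t'))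
      (hM : IsGreedyMatching o d ((R.erase s).erase t) M) :
      IsGreedyMatching o d R ((s, t) :: M)

namespace RAM

/-- Arithmetic expressions; `load a` is the content of the memory cell whose address is `a`
(so direct and indirect addressing are both available). -/
inductive Expr where
  | const (c : ℕ)
  | load (a : Expr)
  | add (e f : Expr)
  | sub (e f : Expr)
  | mul (e f : Expr)
  | div (e f : Expr)

namespace Expr

/-- Number of unit-cost operations needed to evaluate an expression. -/
def cost : Expr → ℕ
  | const _ => 1
  | load a => a.cost + 1
  | add e f => e.cost + f.cost + 1
  | sub e f => e.cost + f.cost + 1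
  | mul e f => e.cost + f.cost + 1
  | div e f => e.cost + f.cost + 1

/-- Value of an expression in a memory (subtraction is truncated at `0`, division rounds down). -/
def eval (mem : ℕ → ℕ) : Expr → ℕ
  | const c => c
  | load a => mem (a.eval mem)
  | add e f => e.eval mem + f.eval mem
  | sub e f => e.eval mem - f.eval mem
  | mul e f => e.eval mem * f.eval mem
  | div e f => e.eval mem / f.eval mem

/-- The evaluation is legal on a machine with `S` memory cells and words of `w` bits: only cells
with addresses below `S` are read, all intermediate results fit into a word, and there is no
division by zero. -/
def Legal (S w : ℕ) (mem : ℕ → ℕ) : Expr → Prop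
  | const c => c < 2 ^ w
  | load a => a.Legal S w mem ∧ a.eval mem < S ∧ mem (a.eval mem) < 2 ^ w
  | add e f => e.Legal S w mem ∧ f.Legal S w mem ∧ e.eval mem + f.eval mem < 2 ^ w
  | sub e f => e.Legal S w mem ∧ f.Legal S w mem
  | mul e f => e.Legal S w mem ∧ f.Legal S w mem ∧ e.eval mem * f.eval mem < 2 ^ w
  | div e f => e.Legal S w mem ∧ f.Legal S w mem ∧ f.eval mem ≠ 0

end Expr

/-- Tests. `distLE i j k l` evaluates the distance between the objects number `i` and `j` and the
distance between the objects number `k` and `l`, and asks whether the former is at most the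
latter; this is the only access to the objects and to their distances. -/
inductive Test where
  | lt (e f : Expr)
  | eq (e f : Expr)
  | distLE (i j k l : Expr)
  | not (b : Test)
  | and (b c : Test)

namespace Test

/-- Number of unit-cost operations of a test; evaluating a distance and comparing two distances are
unit-cost operations. -/
def cost : Test → ℕ
  | lt e f => e.cost + f.cost + 1
  | eq e f => e.cost + f.cost + 1
  | distLE i j k l => i.cost + j.cost + k.cost + l.cost + 3
  | not b => b.cost + 1
  | and b c => b.cost + c.cost + 1

variable {n : ℕ} {D : Type*} [LinearOrder D]

/-- Truth of a test, for the input objects `0, …, n - 1` with distance function `d`. -/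
def Holds (d : Fin n → Fin n → D) (mem : ℕ → ℕ) : Test → Prop
  | lt e f => e.eval mem < f.eval mem
  | eq e f => e.eval mem = f.eval mem
  | distLE i j k l => ∃ (hi : i.eval mem < n) (hj : j.eval mem < n) (hk : k.eval mem < n)
      (hl : l.eval mem < n),
      d ⟨i.eval mem, hi⟩ ⟨j.eval mem, hj⟩ ≤ d ⟨k.eval mem, hk⟩ ⟨l.eval mem, hl⟩
  | not b => ¬ b.Holds d mem
  | and b c => b.Holds d mem ∧ c.Holds d mem

/-- A test is legal if all its expressions are and if distances are only evaluated for existing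
objects. -/
def Legal (n S w : ℕ) (mem : ℕ → ℕ) : Test → Prop
  | lt e f => e.Legal S w mem ∧ f.Legal S w mem
  | eq e f => e.Legal S w mem ∧ f.Legal S w mem
  | distLE i j k l =>
      (i.Legal S w mem ∧ j.Legal S w mem ∧ k.Legal S w mem ∧ l.Legal S w mem) ∧
      (i.eval mem < n ∧ j.eval mem < n ∧ k.eval mem < n ∧ l.eval mem < n)
  | not b => b.Legal n S w mem
  | and b c => b.Legal n S w mem ∧ c.Legal n S w mem

end Test

/-- Programs. `store a e` writes the value of `e` into the cell with address `a`; `emit i j` appends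
the pair of the objects number `i` and `j` to a write-only output; `loop b P` repeats `P` while `b` holds. -/
inductive Program where
  | skip
  | store (a e : Expr)
  | emit (i j : Expr)
  | seq (P Q : Program)
  | ite (b : Test) (P Q : Program)
  | loop (b : Test) (P : Program)

/-- Configurations: the memory and the output written so far. -/
structure State where
  mem : ℕ → ℕ
  out : List (ℕ × ℕ)

/-- Initially cell `0` holds the number `n` of objects, and all else is empty. -/
def State.init (n : ℕ) : State where
  mem := fun a => if a = 0 then n else 0
  out := []

/-- `Exec d S w P σ σ' t`: on a machine with `S` memory cells and words of `w` bits, with input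
objects `0, …, n - 1` and distance function `d`, the program `P` started in `σ` halts in `σ'` after
`t` unit-cost operations. A run that exceeds the memory or the word size is not an execution. -/
inductive Exec {n : ℕ} {D : Type*} [LinearOrder D] (d : Fin n → Fin n → D) (S w : ℕ) :
    Program → State → State → ℕ → Prop
  | skip (σ : State) : Exec d S w .skip σ σ 1
  | store (a e : Expr) (σ : State) (ha : a.Legal S w σ.mem) (he : e.Legal S w σ.mem)
      (haS : a.eval σ.mem < S) :
      Exec d S w (.store a e) σ
        ⟨Function.update σ.mem (a.eval σ.mem) (e.eval σ.mem), σ.out⟩ (a.cost + e.cost + 1)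
  | emit (i j : Expr) (σ : State) (hi : i.Legal S w σ.mem) (hj : j.Legal S w σ.mem) :
      Exec d S w (.emit i j) σ
        ⟨σ.mem, σ.out ++ [(i.eval σ.mem, j.eval σ.mem)]⟩ (i.cost + j.cost + 1)
  | seq (P Q : Program) (σ σ' σ'' : State) (t t' : ℕ) (hP : Exec d S w P σ σ' t)
      (hQ : Exec d S w Q σ' σ'' t') :
      Exec d S w (.seq P Q) σ σ'' (t + t')
  | ite_true (b : Test) (P Q : Program) (σ σ' : State) (t : ℕ) (hl : b.Legal n S w σ.mem)
      (hb : b.Holds d σ.mem) (hP : Exec d S w P σ σ' t) :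
      Exec d S w (.ite b P Q) σ σ' (b.cost + 1 + t)
  | ite_false (b : Test) (P Q : Program) (σ σ' : State) (t : ℕ) (hl : b.Legal n S w σ.mem)
      (hb : ¬ b.Holds d σ.mem) (hQ : Exec d S w Q σ σ' t) :
      Exec d S w (.ite b P Q) σ σ' (b.cost + 1 + t)
  | loop_true (b : Test) (P : Program) (σ σ' σ'' : State) (t t' : ℕ)
      (hl : b.Legal n S w σ.mem) (hb : b.Holds d σ.mem) (hP : Exec d S w P σ σ' t)
      (hW : Exec d S w (.loop b P) σ' σ'' t') :
      Exec d S w (.loop b P) σ σ'' (b.cost + 1 + t + t')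
  | loop_false (b : Test) (P : Program) (σ : State) (hl : b.Legal n S w σ.mem)
      (hb : ¬ b.Holds d σ.mem) :
      Exec d S w (.loop b P) σ σ (b.cost + 1)

/-- The machine is deterministic: a program has at most one halting run from a given state. -/
theorem Exec.deterministic {n : ℕ} {D : Type*} [LinearOrder D] {d : Fin n → Fin n → D} {S w : ℕ}
    {P : Program} {σ σ₁ σ₂ : State} {t₁ t₂ : ℕ} (h₁ : Exec d S w P σ σ₁ t₁)
    (h₂ : Exec d S w P σ σ₂ t₂) : σ₁ = σ₂ ∧ t₁ = t₂ := by
  induction h₁ generalizing σ₂ t₂ with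
  | skip | store | emit => cases h₂; exact ⟨rfl, rfl⟩
  | seq P Q σ σ' σ'' t t' hP hQ ihP ihQ =>
    cases h₂ with
    | seq _ _ _ ρ _ u u' hP' hQ' =>
      obtain ⟨rfl, rfl⟩ := ihP hP'
      obtain ⟨rfl, rfl⟩ := ihQ hQ'
      exact ⟨rfl, rfl⟩
  | ite_true b P Q σ σ' t hl hb hP ih =>
    cases h₂ with
    | ite_true _ _ _ _ _ u _ _ hP' => obtain ⟨rfl, rfl⟩ := ih hP'; exact ⟨rfl, rfl⟩
    | ite_false _ _ _ _ _ u _ hb' _ => exact absurd hb hb'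
  | ite_false b P Q σ σ' t hl hb hQ ih =>
    cases h₂ with
    | ite_true _ _ _ _ _ u _ hb' _ => exact absurd hb' hb
    | ite_false _ _ _ _ _ u _ _ hQ' => obtain ⟨rfl, rfl⟩ := ih hQ'; exact ⟨rfl, rfl⟩
  | loop_true b P σ σ' σ'' t t' hl hb hP hW ihP ihW =>
    cases h₂ with
    | loop_true _ _ _ ρ _ u u' _ _ hP' hW' =>
      obtain ⟨rfl, rfl⟩ := ihP hP'
      obtain ⟨rfl, rfl⟩ := ihW hW'
      exact ⟨rfl, rfl⟩
    | loop_false _ _ _ _ hb' => exact absurd hb hb'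
  | loop_false b P σ hl hb =>
    cases h₂ with
    | loop_true _ _ _ _ _ _ _ _ hb' _ _ => exact absurd hb' hb
    | loop_false _ _ _ _ _ => exact ⟨rfl, rfl⟩

/-- `P` performs greedy matching on every set of `n` objects, for every `n` and every distance
function with values in a linearly ordered type, in time at most `T n` on a machine with `S n`
memory cells and words of `w n` bits: it outputs the selected pairs, in the order of selection. -/
def PerformsGreedyMatching (o : Objective) (P : Program) (T S w : ℕ → ℕ) : Prop :=
  ∀ (n : ℕ) (D : Type u) [LinearOrder D] (d : Fin n → Fin n → D),
    ∃ (σ : State) (t : ℕ) (M : List (Fin n × Fin n)),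
      Exec d (S n) (w n) P (State.init n) σ t ∧ t ≤ T n ∧
      σ.out = M.map (fun p => ((p.1 : ℕ), (p.2 : ℕ))) ∧
      IsGreedyMatching o d Finset.univ M

end RAM

/-! One program proves both claims: time `O(n ^ 2)` and space `O(n)` hold together. Give an
unordered pair the better of its two orientations as its symmetric key (`pairKey`); for farthest
pairs the order is reversed, so that smaller keys are always better.

Instead of following the greedy order, nearest neighbour chains find the matched pairs. A chain is
extended by a nearest unmatched neighbour of its end until this neighbour is the predecessor; then
the last two objects are nearest to each other and are matched. The rest of the chain stays valid,
since removing objects only removes competitors. Hence every pair of objects with a matched member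
meets a matched pair that is at least as good (`Dominates`, preserved by `ChainInv.push` and
`ChainInv.match`).

In the end at most one object is unmatched. Selection sort then emits the matched pairs, best first.
For any two remaining objects, the dominating pair meets them, so it has not been emitted yet;
therefore the best pair not yet emitted is optimal among all remaining pairs (`SortInv.optimal`,
`SortInv.select`).

With `r` unmatched objects and a chain of length `k`, the potential `2 * r - k` falls in each round,
so there are at most `2 * n` rounds of linear cost. The sorting has at most `n` rounds of linear
cost. All data are one array holding a permutation of the objects and six variables. -/

namespace RAM

/-! ### Total correctness with time bounds -/

section Hoare

variable {n : ℕ} {D : Type*} [LinearOrder D]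

/-- `Runs d S w P σ T Q`: started in `σ`, the program `P` halts after at most `T` operations in a
state that satisfies `Q`. -/
def Runs (d : Fin n → Fin n → D) (S w : ℕ) (P : Program) (σ : State) (T : ℕ)
    (Q : State → Prop) : Prop :=
  ∃ (σ' : State) (t : ℕ), Exec d S w P σ σ' t ∧ t ≤ T ∧ Q σ'

variable {d : Fin n → Fin n → D} {S w : ℕ} {P P' : Program} {σ : State} {T T' : ℕ}
  {Q Q' : State → Prop}

theorem Runs.mono (h : Runs d S w P σ T Q) (hT : T ≤ T') (hQ : ∀ σ', Q σ' → Q' σ') :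
    Runs d S w P σ T' Q' := by
  obtain ⟨σ', t, he, ht, hq⟩ := h
  exact ⟨σ', t, he, ht.trans hT, hQ _ hq⟩

theorem Runs.seq (h : Runs d S w P σ T (fun σ' => Runs d S w P' σ' T' Q)) :
    Runs d S w (.seq P P') σ (T + T') Q := by
  obtain ⟨σ', t, he, ht, σ'', t', he', ht', hq⟩ := h
  exact ⟨σ'', t + t', .seq _ _ _ _ _ _ _ he he', by omega, hq⟩

/-- Total correctness of a loop with invariant `I` and variant `μ`, whose body takes at most `C`
operations. -/
theorem Runs.loop {b : Test} {C : ℕ} (I : State → Prop) (μ : State → ℕ)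
    (hl : ∀ σ, I σ → b.Legal n S w σ.mem)
    (hP : ∀ σ, I σ → b.Holds d σ.mem → Runs d S w P σ C (fun σ' => I σ' ∧ μ σ' < μ σ))
    (hσ : I σ) :
    Runs d S w (.loop b P) σ (μ σ * (b.cost + 1 + C) + (b.cost + 1))
      (fun σ' => I σ' ∧ ¬ b.Holds d σ'.mem) := by
  induction hm : μ σ using Nat.strong_induction_on generalizing σ with
  | _ m ih =>
    by_cases hb : b.Holds d σ.mem
    · obtain ⟨σ', t, he, ht, hI, hlt⟩ := hP σ hσ hb
      obtain ⟨σ'', t', he', ht', hq⟩ := ih _ (hm ▸ hlt) hI rfl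
      refine ⟨σ'', _, .loop_true _ _ _ _ _ _ _ (hl σ hσ) hb he he', ?_, hq⟩
      -- The drop of the variant by at least one pays for the current round.
      have h1 : (μ σ' + 1) * (b.cost + 1 + C) ≤ m * (b.cost + 1 + C) :=
        Nat.mul_le_mul_right _ (by omega)
      rw [Nat.add_mul] at h1
      omega
    · exact ⟨σ, _, .loop_false _ _ _ (hl σ hσ) hb, by omega, hσ, hb⟩

/-- An upper bound for the running time of a program without loops. -/
def Program.straightCost : Program → ℕ
  | .skip => 1
  | .store a e => a.cost + e.cost + 1
  | .emit i j => i.cost + j.cost + 1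
  | .seq P Q => P.straightCost + Q.straightCost
  | .ite b P Q => b.cost + 1 + max P.straightCost Q.straightCost
  -- A harmless default: `wp` of a loop is `False`, so a run covered by `wp` never enters one.
  | .loop _ _ => 0

/-- Weakest precondition of a program without loops. -/
def wp (d : Fin n → Fin n → D) (S w : ℕ) : Program → State → (State → Prop) → Prop
  | .skip, σ, Q => Q σ
  | .store a e, σ, Q => a.Legal S w σ.mem ∧ e.Legal S w σ.mem ∧ a.eval σ.mem < S ∧
      Q ⟨Function.update σ.mem (a.eval σ.mem) (e.eval σ.mem), σ.out⟩
  | .emit i j, σ, Q => i.Legal S w σ.mem ∧ j.Legal S w σ.mem ∧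
      Q ⟨σ.mem, σ.out ++ [(i.eval σ.mem, j.eval σ.mem)]⟩
  | .seq P P', σ, Q => wp d S w P σ (fun σ' => wp d S w P' σ' Q)
  | .ite b P P', σ, Q => b.Legal n S w σ.mem ∧ (b.Holds d σ.mem → wp d S w P σ Q) ∧
      (¬ b.Holds d σ.mem → wp d S w P' σ Q)
  | .loop _ _, _, _ => False

theorem Runs.of_wp (h : wp d S w P σ Q) : Runs d S w P σ P.straightCost Q := by
  induction P generalizing σ Q with
  | skip => exact ⟨σ, _, .skip _, le_rfl, h⟩
  | store a e => exact ⟨_, _, .store _ _ _ h.1 h.2.1 h.2.2.1, le_rfl, h.2.2.2⟩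
  | emit i j => exact ⟨_, _, .emit _ _ _ h.1 h.2.1, le_rfl, h.2.2⟩
  | seq P P' ih ih' => exact Runs.seq ((ih h).mono le_rfl fun _ h' => ih' h')
  | ite b P P' ih ih' =>
    obtain ⟨hl, h1, h2⟩ := h
    by_cases hb : b.Holds d σ.mem
    · obtain ⟨σ', t, he, ht, hq⟩ := ih (h1 hb)
      refine ⟨σ', _, .ite_true _ _ _ _ _ _ hl hb he, ?_, hq⟩
      simp only [Program.straightCost]
      omega
    · obtain ⟨σ', t, he, ht, hq⟩ := ih' (h2 hb)
      refine ⟨σ', _, .ite_false _ _ _ _ _ _ hl hb he, ?_, hq⟩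
      simp only [Program.straightCost]
      omega
  | loop b P => exact h.elim

end Hoare

/-! ### Memory as six variables and an array -/

section Memory

/-- The memory with the variables `n`, `r`, `k`, `b`, `j`, `t` in the cells `0, …, 5`, followed by the
array `A`. -/
def layout (n r k b j t : ℕ) (A : ℕ → ℕ) : ℕ → ℕ
  | 0 => n
  | 1 => r
  | 2 => k
  | 3 => b
  | 4 => j
  | 5 => t
  | i + 6 => A i

variable {n r k b j t i v : ℕ} {A : ℕ → ℕ}

@[simp] theorem layout_zero : layout n r k b j t A 0 = n := rfl
@[simp] theorem layout_one : layout n r k b j t A 1 = r := rfl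
@[simp] theorem layout_two : layout n r k b j t A 2 = k := rfl
@[simp] theorem layout_three : layout n r k b j t A 3 = b := rfl
@[simp] theorem layout_four : layout n r k b j t A 4 = j := rfl
@[simp] theorem layout_five : layout n r k b j t A 5 = t := rfl
@[simp] theorem layout_add : layout n r k b j t A (6 + i) = A i := by
  rw [Nat.add_comm]; rfl

theorem ext_layout {f g : ℕ → ℕ} (h0 : f 0 = g 0) (h1 : f 1 = g 1) (h2 : f 2 = g 2)
    (h3 : f 3 = g 3) (h4 : f 4 = g 4) (h5 : f 5 = g 5) (h : ∀ i, f (i + 6) = g (i + 6)) :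
    f = g := by
  funext x
  match x with
  | 0 => exact h0
  | 1 => exact h1
  | 2 => exact h2
  | 3 => exact h3
  | 4 => exact h4
  | 5 => exact h5
  | i + 6 => exact h i

@[simp] theorem update_layout_one :
    Function.update (layout n r k b j t A) 1 v = layout n v k b j t A := by
  apply ext_layout <;> simp [Function.update, layout]

@[simp] theorem update_layout_two :
    Function.update (layout n r k b j t A) 2 v = layout n r v b j t A := by
  apply ext_layout <;> simp [Function.update, layout]

@[simp] theorem update_layout_three :
    Function.update (layout n r k b j t A) 3 v = layout n r k v j t A := by
  apply ext_layout <;> simp [Function.update, layout]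

@[simp] theorem update_layout_four :
    Function.update (layout n r k b j t A) 4 v = layout n r k b v t A := by
  apply ext_layout <;> simp [Function.update, layout]

@[simp] theorem update_layout_five :
    Function.update (layout n r k b j t A) 5 v = layout n r k b j v A := by
  apply ext_layout <;> simp [Function.update, layout]

@[simp] theorem update_layout_add :
    Function.update (layout n r k b j t A) (6 + i) v =
      layout n r k b j t (Function.update A i v) := by
  apply ext_layout <;> try (rw [Function.update_of_ne (by omega)]; rfl)
  intro x
  rw [Nat.add_comm x 6]
  simp [Function.update, layout_add]

theorem init_mem (n : ℕ) : (State.init n).mem = layout n 0 0 0 0 0 (fun _ => 0) := by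
  apply ext_layout <;> simp [State.init, layout]

end Memory

namespace Expr

/-- The content of the cell `c`. -/
abbrev var (c : ℕ) : Expr := .load (.const c)

/-- The address of the entry number `e` of the array. -/
abbrev addr (e : Expr) : Expr := .add (.const 6) e

/-- The entry number `e` of the array. -/
abbrev entry (e : Expr) : Expr := .load (addr e)

end Expr

/-! ### Exchanging array entries -/

section Swap

open RAM.Expr

/-- Exchange the entries number `e` and `f` of the array. -/
def swapEntries (e f : Expr) : Program :=
  .seq (.store (.const 5) (entry f)) (.seq (.store (addr f) (entry e)) (.store (addr e) (var 5)))

variable {n : ℕ} {D : Type*} [LinearOrder D] {d : Fin n → Fin n → D} {w : ℕ} {Q : State → Prop}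
  {r k b j t x y : ℕ} {A : ℕ → ℕ} {out : List (ℕ × ℕ)} {e f : Expr}

/-- The index expressions are evaluated again after cell `5` and the array have changed, so their
values and legality must not depend on either. -/
theorem wp_swapEntries (hw : n + 9 ≤ 2 ^ w) (hA : ∀ i < n, A i < n)
    (he : ∀ t A, e.eval (layout n r k b j t A) = x) (hf : ∀ t A, f.eval (layout n r k b j t A) = y)
    (hel : ∀ t A, t < n + 9 → e.Legal (n + 6) w (layout n r k b j t A))
    (hfl : ∀ t A, t < n + 9 → f.Legal (n + 6) w (layout n r k b j t A))
    (hx : x < n) (hy : y < n) (ht : t < n + 9)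
    (hQ : ∀ t < n + 9, Q ⟨layout n r k b j t (A ∘ Equiv.swap x y), out⟩) :
    wp d (n + 6) w (swapEntries e f) ⟨layout n r k b j t A, out⟩ Q := by
  have h1 := hA x hx
  have h2 := hA y hy
  have h3 := hQ (A y) (by omega)
  rw [Equiv.comp_swap_eq_update] at h3
  have e1 := hel t A ht
  have e2 := hel (A y) A (by omega)
  have e3 := hel (A y) (Function.update A y (A x)) (by omega)
  have f1 := hfl t A ht
  have f2 := hfl (A y) A (by omega)
  simp only [swapEntries, wp, Expr.Legal, Expr.eval, he, hf, update_layout_five, update_layout_add,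
    layout_add, layout_five]
  refine ⟨?_, ⟨⟨?_, f1, ?_⟩, ?_, ?_⟩, ?_, ⟨?_, f2, ?_⟩, ⟨⟨?_, e2, ?_⟩, ?_, ?_⟩, ?_,
    ⟨?_, e3, ?_⟩, ⟨?_, ?_, ?_⟩, ?_, h3⟩ <;> omega

end Swap

/-! ### Keys of ordered and unordered pairs -/

section Comparison

open RAM.Expr

/-- Whether the pair of objects `(i, j)` is at least as good a selection as the pair `(k, l)`. -/
def prefTest : Objective → Expr → Expr → Expr → Expr → Test
  | .closest, i, j, k, l => .distLE i j k l
  | .farthest, i, j, k, l => .distLE k l i j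

/-- Disjunction of tests. -/
def orTest (b c : Test) : Test := .not (.and (.not b) (.not c))

/-- Whether the pair `{i, j}`, in its better orientation, is at least as good a selection as the pair
`{k, l}`, in its better orientation. -/
def pairTest (o : Objective) (i j k l : Expr) : Test :=
  .and (orTest (prefTest o i j k l) (prefTest o j i k l))
    (orTest (prefTest o i j l k) (prefTest o j i l k))

/-- `e` is a key of the ordered pairs of objects: better pairs have smaller keys. -/
def IsKey {n : ℕ} {D F : Type*} [LinearOrder D] [LinearOrder F] (o : Objective)
    (d : Fin n → Fin n → D) (e : ℕ → ℕ → F) : Prop :=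
  ∀ i j k l : Fin n, o.Prefers (d i j) (d k l) ↔ e i j ≤ e k l

/-- Passing to the order dual reduces farthest to closest pairs. Array entries are plain numbers, so
`e` must be total on `ℕ`; `⊤` is the filler, which also works for empty `D`. -/
theorem exists_isKey {n : ℕ} {D : Type u} [LinearOrder D] (o : Objective) (d : Fin n → Fin n → D) :
    ∃ (F : Type u) (_ : LinearOrder F) (e : ℕ → ℕ → F), IsKey o d e := by
  cases o with
  | closest =>
    refine ⟨WithTop D, inferInstance,
      fun i j => if h : i < n ∧ j < n then (d ⟨i, h.1⟩ ⟨j, h.2⟩ : WithTop D) else ⊤, ?_⟩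
    intro i j k l
    simp [Objective.Prefers]
  | farthest =>
    refine ⟨WithTop Dᵒᵈ, inferInstance, fun i j =>
      if h : i < n ∧ j < n then WithTop.some (OrderDual.toDual (d ⟨i, h.1⟩ ⟨j, h.2⟩)) else ⊤, ?_⟩
    intro i j k l
    simp [Objective.Prefers]

/-- The key of an unordered pair. -/
def pairKey {F : Type*} [LinearOrder F] (e : ℕ → ℕ → F) (i j : ℕ) : F := min (e i j) (e j i)

theorem pairKey_comm {F : Type*} [LinearOrder F] (e : ℕ → ℕ → F) (i j : ℕ) :
    pairKey e i j = pairKey e j i := min_comm _ _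

variable {n : ℕ} {D F : Type*} [LinearOrder D] [LinearOrder F] {o : Objective}
  {d : Fin n → Fin n → D} {e : ℕ → ℕ → F} {S w : ℕ} {mem : ℕ → ℕ} {i j k l : Expr}

theorem prefTest_legal (hi : i.Legal S w mem) (hj : j.Legal S w mem) (hk : k.Legal S w mem)
    (hl : l.Legal S w mem) (hin : i.eval mem < n) (hjn : j.eval mem < n) (hkn : k.eval mem < n)
    (hln : l.eval mem < n) : (prefTest o i j k l).Legal n S w mem := by
  cases o
  · exact ⟨⟨hi, hj, hk, hl⟩, hin, hjn, hkn, hln⟩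
  · exact ⟨⟨hk, hl, hi, hj⟩, hkn, hln, hin, hjn⟩

theorem prefTest_holds (he : IsKey o d e) (hin : i.eval mem < n) (hjn : j.eval mem < n)
    (hkn : k.eval mem < n) (hln : l.eval mem < n) :
    (prefTest o i j k l).Holds d mem ↔
      e (i.eval mem) (j.eval mem) ≤ e (k.eval mem) (l.eval mem) := by
  rw [← he ⟨_, hin⟩ ⟨_, hjn⟩ ⟨_, hkn⟩ ⟨_, hln⟩]
  cases o <;> simp [prefTest, Test.Holds, Objective.Prefers, hin, hjn, hkn, hln]

theorem pairTest_legal (hi : i.Legal S w mem) (hj : j.Legal S w mem) (hk : k.Legal S w mem)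
    (hl : l.Legal S w mem) (hin : i.eval mem < n) (hjn : j.eval mem < n) (hkn : k.eval mem < n)
    (hln : l.eval mem < n) : (pairTest o i j k l).Legal n S w mem := by
  simp [pairTest, orTest, Test.Legal, prefTest_legal, *]

theorem pairTest_holds (he : IsKey o d e) (hin : i.eval mem < n) (hjn : j.eval mem < n)
    (hkn : k.eval mem < n) (hln : l.eval mem < n) :
    (pairTest o i j k l).Holds d mem ↔
      pairKey e (i.eval mem) (j.eval mem) ≤ pairKey e (k.eval mem) (l.eval mem) := by
  simp only [pairTest, orTest, Test.Holds, prefTest_holds he, *, pairKey]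
  rw [le_min_iff, min_le_iff, min_le_iff]
  tauto

end Comparison

/-! ### Arrays that hold a permutation of the objects -/

/-- The entries of `A` with numbers below `n` are distinct objects. -/
structure Enumerates (n : ℕ) (A : ℕ → ℕ) : Prop where
  lt : ∀ i < n, A i < n
  inj : ∀ i < n, ∀ j < n, A i = A j → i = j

theorem swap_lt {n x y i : ℕ} (hx : x < n) (hy : y < n) (hi : i < n) : Equiv.swap x y i < n := by
  rw [Equiv.swap_apply_def]
  split_ifs <;> assumption

theorem Enumerates.swap {n x y : ℕ} {A : ℕ → ℕ} (h : Enumerates n A) (hx : x < n) (hy : y < n) :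
    Enumerates n (A ∘ Equiv.swap x y) where
  lt _ hi := h.lt _ (swap_lt hx hy hi)
  inj _ hi _ hj hij :=
    (Equiv.swap x y).injective (h.inj _ (swap_lt hx hy hi) _ (swap_lt hx hy hj) hij)

theorem Enumerates.surj {n x : ℕ} {A : ℕ → ℕ} (h : Enumerates n A) (hx : x < n) :
    ∃ i < n, A i = x := by
  have hf : Function.Injective (fun i : Fin n => (⟨A i, h.lt i i.2⟩ : Fin n)) := by
    intro i j hij
    exact Fin.ext (h.inj i i.2 j j.2 (by simpa using hij))
  obtain ⟨i, hi⟩ := Finite.surjective_of_injective hf ⟨x, hx⟩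
  exact ⟨i, i.2, by simpa using hi⟩

/-! ### Nearest neighbour chains -/

section

variable {F : Type*} [LinearOrder F]

/-- The entries of `A` at the positions `p ≤ i, i + 1, … < n` form consecutive pairs such that each
pair of objects whose positions satisfy `V` meets one of these pairs that is at least as good. -/
def Dominates (e : ℕ → ℕ → F) (n p : ℕ) (A : ℕ → ℕ) (V : ℕ → ℕ → Prop) : Prop :=
  ∀ x < n, ∀ y < n, x ≠ y → V x y → ∃ i, p ≤ i ∧ i + 1 < n ∧ i % 2 = p % 2 ∧
    (x = i ∨ x = i + 1 ∨ y = i ∨ y = i + 1) ∧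
    pairKey e (A i) (A (i + 1)) ≤ pairKey e (A x) (A y)

/-- Invariant of the nearest neighbour chain algorithm: the objects at the positions below `r` are
unmatched, those below `k` form a chain in which each object is followed by a nearest
neighbour, and the pairs from position `r` on are matched. -/
structure ChainInv (e : ℕ → ℕ → F) (n r k : ℕ) (A : ℕ → ℕ) : Prop where
  enum : Enumerates n A
  r_le : r ≤ n
  parity : r % 2 = n % 2
  k_le : k ≤ r
  chain : ∀ i, i + 1 < k → ∀ x < r, x ≠ i →
    pairKey e (A i) (A (i + 1)) ≤ pairKey e (A i) (A x)
  dom : Dominates e n r A (fun x y => r ≤ x ∨ r ≤ y)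

variable {e : ℕ → ℕ → F} {n r k b : ℕ} {A : ℕ → ℕ}

theorem ChainInv.start (h : ChainInv e n r 0 A) (hr : 1 < r) : ChainInv e n r 1 A where
  enum := h.enum
  r_le := h.r_le
  parity := h.parity
  k_le := hr.le
  chain i hi := by omega
  dom := h.dom

/-- The candidate `b` is a nearest neighbour of the end of the chain. -/
theorem ChainInv.nearest (h : ChainInv e n r k A) (hb : ∀ x, k ≤ x ∨ x + 2 = k → x < r →
      pairKey e (A (k - 1)) (A b) ≤ pairKey e (A (k - 1)) (A x)) :
    ∀ x < r, x ≠ k - 1 → pairKey e (A (k - 1)) (A b) ≤ pairKey e (A (k - 1)) (A x) := by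
  intro x hx hxk
  by_cases hx2 : k ≤ x ∨ x + 2 = k
  · exact hb x hx2 hx
  · have hk := h.k_le
    obtain ⟨l, rfl⟩ : ∃ l, k = l + 2 := ⟨k - 2, by omega⟩
    simp only [show l + 2 - 1 = l + 1 from rfl] at *
    have h1 := hb l (by omega) (by omega)
    -- Keys never increase along the chain: the predecessor of an object competes for being its
    -- nearest neighbour. So the last link is at least as good as the link at `x`.
    have h3 : pairKey e (A (l + 1)) (A l) ≤ pairKey e (A x) (A (x + 1)) := by
      have : ∀ q, x + q + 1 < l + 2 →
          pairKey e (A (x + q)) (A (x + q + 1)) ≤ pairKey e (A x) (A (x + 1)) := by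
        intro q
        induction q with
        | zero => intro _; exact le_rfl
        | succ q ih =>
          intro hq
          refine le_trans ?_ (ih (by omega))
          rw [pairKey_comm e (A (x + q))]
          exact h.chain (x + (q + 1)) (by omega) (x + q) (by omega) (by omega)
      have := this (l - x) (by omega)
      rwa [show x + (l - x) = l by omega, pairKey_comm] at this
    -- The end of the chain itself competed when the link at `x` was chosen.
    refine h1.trans (h3.trans ?_)
    rw [pairKey_comm e (A (l + 1))]
    exact h.chain x (by omega) (l + 1) (by omega) (by omega)

/-- The swap only touches positions outside the chain and below `r`, so old links and matched pairs
stay in place. Ties are harmless: the candidates are the predecessor and objects outside the chain,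
so no chain can cycle. -/
theorem ChainInv.push (h : ChainInv e n r k A) (hk : 1 ≤ k) (hkb : k ≤ b) (hbr : b < r)
    (hb : ∀ x, k ≤ x ∨ x + 2 = k → x < r →
      pairKey e (A (k - 1)) (A b) ≤ pairKey e (A (k - 1)) (A x)) :
    ChainInv e n r (k + 1) (A ∘ Equiv.swap k b) where
  enum := h.enum.swap (by have := h.r_le; omega) (by have := h.r_le; omega)
  r_le := h.r_le
  parity := h.parity
  k_le := by omega
  chain i hi x hx hxi := by
    have hb' := h.nearest hb
    have hi' : Equiv.swap k b i = i := Equiv.swap_apply_of_ne_of_ne (by omega) (by omega)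
    have hx1 : Equiv.swap k b x < r := swap_lt (by omega) hbr hx
    have hx2 : Equiv.swap k b x ≠ i := by
      rw [← hi']; exact (Equiv.swap k b).injective.ne hxi
    simp only [Function.comp_apply, hi']
    by_cases hik : i + 1 = k
    · obtain rfl : i = k - 1 := by omega
      rw [hik, Equiv.swap_apply_left]
      exact hb' _ hx1 hx2
    · rw [Equiv.swap_apply_of_ne_of_ne (by omega) (by omega)]
      exact h.chain i (by omega) _ hx1 hx2
  dom x hx y hy hxy hV := by
    have hn := h.r_le
    have fixed : ∀ i, r ≤ i → Equiv.swap k b i = i := fun i hi =>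
      Equiv.swap_apply_of_ne_of_ne (by omega) (by omega)
    have small : ∀ i, i < r → Equiv.swap k b i < r := fun i hi => swap_lt (by omega) hbr hi
    obtain ⟨i, h1, h2, h3, h4, h5⟩ := h.dom (Equiv.swap k b x)
      (swap_lt (by omega) (by omega) hx) (Equiv.swap k b y) (swap_lt (by omega) (by omega) hy)
      ((Equiv.swap k b).injective.ne hxy) (by
        rcases hV with hV | hV
        · left; rwa [fixed x hV]
        · right; rwa [fixed y hV])
    have fx := fixed x
    have fy := fixed y
    have sx := small x
    have sy := small y
    refine ⟨i, h1, h2, h3, by omega, ?_⟩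
    simpa only [Function.comp_apply, fixed i h1, fixed (i + 1) (by omega)] using h5

/-- The permutation that moves the last two positions of a chain to the last two positions. -/
def matchPerm (r k : ℕ) : Equiv.Perm ℕ :=
  Equiv.swap (k - 1) (r - 1) * Equiv.swap (k - 2) (r - 2)

/-- The delicate case is `k = r - 1`, where `k - 1 = r - 2` lies in both swaps and their order
matters. -/
theorem matchPerm_apply {i : ℕ} (hk : 2 ≤ k) (hr : k ≤ r) :
    (r ≤ i → matchPerm r k i = i) ∧ (i < r → matchPerm r k i < r) ∧
    (i < k - 2 → matchPerm r k i = i) ∧ (i = r - 2 → matchPerm r k i = k - 2) ∧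
    (i = r - 1 → matchPerm r k i = k - 1) := by
  simp only [matchPerm, Equiv.Perm.mul_apply, Equiv.swap_apply_def]
  split_ifs <;> omega

/-- The last two objects are nearest to each other, so the new pair is at least as good as any
unmatched pair that meets it. Pairs that met an older match keep their old dominating pair. -/
theorem ChainInv.match (h : ChainInv e n r k A) (hk : 2 ≤ k)
    (hb : ∀ x, k ≤ x ∨ x + 2 = k → x < r →
      pairKey e (A (k - 1)) (A (k - 2)) ≤ pairKey e (A (k - 1)) (A x)) :
    ChainInv e n (r - 2) (k - 2) (A ∘ matchPerm r k) where
  enum := by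
    have := h.r_le
    have := h.k_le
    exact (h.enum.swap (x := k - 1) (y := r - 1) (by omega) (by omega)).swap (x := k - 2)
      (y := r - 2) (by omega) (by omega)
  r_le := by have := h.r_le; omega
  parity := by have := h.parity; have := h.k_le; omega
  k_le := by have := h.k_le; omega
  chain i hi x hx hxi := by
    have hkr := h.k_le
    have hi1 := (matchPerm_apply (i := i) hk hkr).2.2.1 (by omega)
    have hi2 := (matchPerm_apply (i := i + 1) hk hkr).2.2.1 (by omega)
    simp only [Function.comp_apply, hi1, hi2]
    refine h.chain i (by omega) _ ((matchPerm_apply hk hkr).2.1 (by omega)) ?_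
    rw [← hi1]
    exact (matchPerm r k).injective.ne hxi
  dom x hx y hy hxy hV := by
    have hkr := h.k_le
    have hn := h.r_le
    have fixed : ∀ {z}, r ≤ z → matchPerm r k z = z := fun hz => (matchPerm_apply hk hkr).1 hz
    have small : ∀ {z}, z < r → matchPerm r k z < r := fun hz => (matchPerm_apply hk hkr).2.1 hz
    have bounded : ∀ {z}, z < n → matchPerm r k z < n := by
      intro z hz
      rcases lt_or_ge z r with hzr | hzr
      · exact (small hzr).trans_le hn
      · rwa [fixed hzr]
    have fst : matchPerm r k (r - 2) = k - 2 := (matchPerm_apply hk hkr).2.2.2.1 rfl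
    have snd : matchPerm r k (r - 1) = k - 1 := (matchPerm_apply hk hkr).2.2.2.2 rfl
    have hne := (matchPerm r k).injective.ne hxy
    by_cases hr : r ≤ x ∨ r ≤ y
    · obtain ⟨i, h1, h2, h3, h4, h5⟩ := h.dom _ (bounded hx) _ (bounded hy) hne
        (hr.imp (fun h => (fixed h).symm ▸ h) (fun h => (fixed h).symm ▸ h))
      have pull : ∀ {z l}, r ≤ l → matchPerm r k z = l → z = l := fun hl hz =>
        (matchPerm r k).injective (hz.trans (fixed hl).symm)
      refine ⟨i, by omega, h2, by omega, h4.imp (pull h1) (Or.imp (pull (by omega))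
        (Or.imp (pull h1) (pull (by omega)))), ?_⟩
      simpa only [Function.comp_apply, fixed h1, fixed (h1.trans (Nat.le_succ i))] using h5
    · have hxr : matchPerm r k x < r := small (by omega)
      have hyr : matchPerm r k y < r := small (by omega)
      have near := h.nearest hb
      -- The last link of the chain gives this direction; `near` comes from the search.
      have near' : ∀ z < r, z ≠ k - 2 →
          pairKey e (A (k - 1)) (A (k - 2)) ≤ pairKey e (A (k - 2)) (A z) := by
        intro z hz hzk
        have := h.chain (k - 2) (by omega) z hz hzk
        rwa [show k - 2 + 1 = k - 1 by omega, pairKey_comm] at this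
      refine ⟨r - 2, le_rfl, by omega, rfl, by omega, ?_⟩
      simp only [Function.comp_apply, show r - 2 + 1 = r - 1 by omega, fst, snd]
      rw [pairKey_comm e (A (k - 2))]
      by_cases x1 : x = r - 1
      · rw [x1, snd] at hne ⊢
        exact near _ hyr hne.symm
      by_cases x2 : x = r - 2
      · rw [x2, fst] at hne ⊢
        exact near' _ hyr hne.symm
      rw [pairKey_comm e (A (matchPerm r k x))]
      by_cases y1 : y = r - 1
      · rw [y1, snd] at hne ⊢
        exact near _ hxr hne
      · obtain rfl : y = r - 2 := by omega
        rw [fst] at hne ⊢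
        exact near' _ hxr hne

/-! ### Sorting the matched pairs -/

/-- Invariant of the sorting of the matched pairs: the pairs at the positions from `r` to `p` have been
sorted, and those from `p` on have not. -/
structure SortInv (e : ℕ → ℕ → F) (n r p : ℕ) (A : ℕ → ℕ) : Prop where
  enum : Enumerates n A
  r_le : r ≤ 1
  r_le_p : r ≤ p
  p_le : p ≤ n
  parity : p % 2 = n % 2
  dom : Dominates e n p A (fun x y => (x < r ∨ p ≤ x) ∧ (y < r ∨ p ≤ y))

/-- Two distinct positions cannot both lie below `r ≤ 1`, so domination now covers all pairs. -/
theorem ChainInv.sortInv (h : ChainInv e n r k A) (hr : r ≤ 1) : SortInv e n r r A where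
  enum := h.enum
  r_le := hr
  r_le_p := le_rfl
  p_le := h.r_le
  parity := h.parity
  dom x hx y hy hxy _ := h.dom x hx y hy hxy (by omega)

/-- The permutation that exchanges the pairs at the positions `b` and `p`. -/
def blockPerm (b p : ℕ) : Equiv.Perm ℕ :=
  Equiv.swap b p * Equiv.swap (b + 1) (p + 1)

section

variable {p i : ℕ}

theorem blockPerm_self (hb : p ≤ b) (hbp : b % 2 = p % 2) : blockPerm b p p = b := by
  simp only [blockPerm, Equiv.Perm.mul_apply, Equiv.swap_apply_def]
  split_ifs <;> omega

theorem blockPerm_self_succ (hbp : b % 2 = p % 2) : blockPerm b p (p + 1) = b + 1 := by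
  simp only [blockPerm, Equiv.Perm.mul_apply, Equiv.swap_apply_def]
  split_ifs <;> omega

theorem blockPerm_left (hb : p ≤ b) (hbp : b % 2 = p % 2) : blockPerm b p b = p := by
  simp only [blockPerm, Equiv.Perm.mul_apply, Equiv.swap_apply_def]
  split_ifs <;> omega

theorem blockPerm_left_succ (hbp : b % 2 = p % 2) : blockPerm b p (b + 1) = p + 1 := by
  simp only [blockPerm, Equiv.Perm.mul_apply, Equiv.swap_apply_def]
  split_ifs <;> omega

theorem blockPerm_of_lt (hb : p ≤ b) (hbp : b % 2 = p % 2) (hi : i < p) : blockPerm b p i = i := by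
  simp only [blockPerm, Equiv.Perm.mul_apply, Equiv.swap_apply_def]
  split_ifs <;> omega

theorem blockPerm_of_ne (hb : p ≤ b) (hbp : b % 2 = p % 2) (h1 : i ≠ b) (h2 : i ≠ b + 1)
    (h3 : i ≠ p) (h4 : i ≠ p + 1) : blockPerm b p i = i := by
  simp only [blockPerm, Equiv.Perm.mul_apply, Equiv.swap_apply_def]
  split_ifs <;> omega

theorem le_blockPerm (hb : p ≤ b) (hbp : b % 2 = p % 2) (hi : p ≤ i) : p ≤ blockPerm b p i := by
  simp only [blockPerm, Equiv.Perm.mul_apply, Equiv.swap_apply_def]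
  split_ifs <;> omega

end

/-- Matched pairs are disjoint, so two objects outside the departing pair are never dominated
through it: the dominating pair must contain one of them. -/
theorem SortInv.step {p : ℕ} (h : SortInv e n r p A) (hpb : p ≤ b) (hb : b % 2 = p % 2)
    (hbn : b + 1 < n) : SortInv e n r (p + 2) (A ∘ blockPerm b p) where
  enum := (h.enum.swap (by omega) (by omega)).swap (by omega) (by omega)
  r_le := h.r_le
  r_le_p := by have := h.r_le_p; omega
  p_le := by omega
  parity := by have := h.parity; omega
  dom x hx y hy hxy hV := by
    have hr := h.r_le_p
    have hinj := (blockPerm b p).injective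
    have bounded : ∀ z < n, blockPerm b p z < n := fun z hz =>
      swap_lt (by omega) (by omega) (swap_lt (by omega) (by omega) hz)
    have valid : ∀ z, z < r ∨ p + 2 ≤ z → blockPerm b p z < r ∨ p ≤ blockPerm b p z := by
      rintro z (hz | hz)
      · left; rwa [blockPerm_of_lt hpb hb (by omega)]
      · exact .inr (le_blockPerm hpb hb (by omega))
    have pull : ∀ {z i l}, blockPerm b p l = i → blockPerm b p z = i → z = l := fun hl hz =>
      hinj (hz.trans hl.symm)
    obtain ⟨i, h1, h2, h3, h4, h5⟩ := h.dom _ (bounded x hx) _ (bounded y hy) (hinj.ne hxy)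
      ⟨valid x hV.1, valid y hV.2⟩
    have reduce : ∀ l, p + 2 ≤ l → l + 1 < n → l % 2 = p % 2 → blockPerm b p l = i →
        blockPerm b p (l + 1) = i + 1 → ∃ i, p + 2 ≤ i ∧ i + 1 < n ∧ i % 2 = (p + 2) % 2 ∧
        (x = i ∨ x = i + 1 ∨ y = i ∨ y = i + 1) ∧
        pairKey e ((A ∘ blockPerm b p) i) ((A ∘ blockPerm b p) (i + 1)) ≤
          pairKey e ((A ∘ blockPerm b p) x) ((A ∘ blockPerm b p) y) := by
      intro l hl hln hlp e1 e2
      refine ⟨l, hl, hln, by omega, h4.imp (pull e1) (Or.imp (pull e2)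
        (Or.imp (pull e1) (pull e2))), ?_⟩
      simpa only [Function.comp_apply, e1, e2] using h5
    have hib : i ≠ b := by
      rintro rfl
      have e1 := blockPerm_self hpb hb
      have e2 := blockPerm_self_succ hb
      have := h4.imp (pull e1) (Or.imp (pull e2) (Or.imp (pull e1) (pull e2)))
      omega
    by_cases hip : i = p
    -- The pair displaced from `p` is now found at `b`.
    · subst hip
      exact reduce b (by omega) hbn hb (blockPerm_left hpb hb) (blockPerm_left_succ hb)
    · exact reduce i (by omega) h2 h3
        (blockPerm_of_ne hpb hb (by omega) (by omega) (by omega) (by omega))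
        (blockPerm_of_ne hpb hb (by omega) (by omega) (by omega) (by omega))

theorem SortInv.optimal {p : ℕ} (h : SortInv e n r p A)
    (hb : ∀ i, p ≤ i → i % 2 = p % 2 → i + 1 < n →
      pairKey e (A b) (A (b + 1)) ≤ pairKey e (A i) (A (i + 1)))
    {x y : ℕ} (hx : x < n) (hy : y < n) (hxy : x ≠ y) (hxp : x < r ∨ p ≤ x) (hyp : y < r ∨ p ≤ y) :
    pairKey e (A b) (A (b + 1)) ≤ e (A x) (A y) := by
  obtain ⟨i, h1, h2, h3, -, h5⟩ := h.dom x hx y hy hxy ⟨hxp, hyp⟩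
  exact (hb i h1 h3 h2).trans (h5.trans (min_le_left _ _))

end

/-! ### From the sorted pairs to a run of greedy matching -/

/-- The objects that are at none of the positions from `r` to `p`. -/
def remaining {n : ℕ} (r p : ℕ) (A : ℕ → ℕ) : Finset (Fin n) :=
  Finset.univ.filter (fun x => ∀ i, r ≤ i → i < p → A i ≠ x)

section

variable {n r p b : ℕ} {D F : Type*} [LinearOrder D] [LinearOrder F] {o : Objective}
  {d : Fin n → Fin n → D} {e : ℕ → ℕ → F} {A : ℕ → ℕ}

theorem exists_position (h : Enumerates n A) {x : Fin n} (hx : x ∈ remaining r p A) :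
    ∃ i < n, A i = x ∧ (i < r ∨ p ≤ i) := by
  obtain ⟨i, hi, hix⟩ := h.surj x.2
  refine ⟨i, hi, hix, ?_⟩
  by_contra! hc
  simp only [remaining, Finset.mem_filter, Finset.mem_univ, true_and] at hx
  exact hx i hc.1 hc.2 hix

theorem mem_remaining (h : Enumerates n A) {i : ℕ} {x : Fin n} (hi : i < n) (hix : A i = x)
    (hip : p ≤ i) : x ∈ remaining r p A := by
  simp only [remaining, Finset.mem_filter, Finset.mem_univ, true_and]
  intro l _ hl heq
  have := h.inj l (by omega) i hi (heq.trans hix.symm)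
  omega

theorem SortInv.done (h : SortInv e n r n A) : IsGreedyMatching o d (remaining r n A) [] := by
  refine .done _ (Finset.card_le_one.2 fun x hx y hy => ?_)
  obtain ⟨i, hi, hix, hir⟩ := exists_position h.enum hx
  obtain ⟨j, hj, hjy, hjr⟩ := exists_position h.enum hy
  have := h.r_le
  obtain rfl : i = j := by omega
  exact Fin.ext (hix.symm.trans hjy)

/-- Greedy matching may select the best pair, in its better orientation. -/
theorem SortInv.select (he : IsKey o d e) (h : SortInv e n r p A) (hpb : p ≤ b)
    (hb2 : b % 2 = p % 2) (hbn : b + 1 < n)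
    (hb : ∀ i, p ≤ i → i % 2 = p % 2 → i + 1 < n →
      pairKey e (A b) (A (b + 1)) ≤ pairKey e (A i) (A (i + 1)))
    {s t : Fin n} (hst : A b = s ∧ A (b + 1) = t ∨ A b = t ∧ A (b + 1) = s)
    (hle : e s t ≤ e t s) {M : List (Fin n × Fin n)}
    (hM : IsGreedyMatching o d (remaining r (p + 2) (A ∘ blockPerm b p)) M) :
    IsGreedyMatching o d (remaining r p A) ((s, t) :: M) := by
  have hkey : e s t = pairKey e (A b) (A (b + 1)) := by
    rcases hst with ⟨h1, h2⟩ | ⟨h1, h2⟩ <;> simp [pairKey, h1, h2, hle]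
  have hs : s ∈ remaining r p A := by
    rcases hst with ⟨h1, h2⟩ | ⟨h1, h2⟩
    · exact mem_remaining h.enum (by omega) h1 hpb
    · exact mem_remaining h.enum hbn h2 (by omega)
  have ht : t ∈ remaining r p A := by
    rcases hst with ⟨h1, h2⟩ | ⟨h1, h2⟩
    · exact mem_remaining h.enum hbn h2 (by omega)
    · exact mem_remaining h.enum (by omega) h1 hpb
  refine .select _ s t M hs ht ?_ ?_ ?_
  · rintro rfl
    have := h.enum.inj b (by omega) (b + 1) hbn
    rcases hst with ⟨h1, h2⟩ | ⟨h1, h2⟩ <;> simp [h1, h2] at this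
  · intro s' hs' t' ht' hne
    obtain ⟨x, hx, hxs, hxp⟩ := exists_position h.enum hs'
    obtain ⟨y, hy, hyt, hyp⟩ := exists_position h.enum ht'
    rw [he, hkey, ← hxs, ← hyt]
    refine h.optimal hb hx hy ?_ hxp hyp
    rintro rfl
    exact hne (Fin.ext (hxs.symm.trans hyt))
  -- Erasing `s` and `t` amounts to moving them to the positions `p`, `p + 1` and advancing `p` by
  -- two.
  · convert hM using 1
    have hr := h.r_le_p
    ext z
    simp only [remaining, Finset.mem_filter, Finset.mem_univ, true_and, Finset.mem_erase,
      Function.comp_apply]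
    have c1 : blockPerm b p p = b := blockPerm_self hpb hb2
    have c2 : blockPerm b p (p + 1) = b + 1 := blockPerm_self_succ hb2
    have c3 : ∀ i, i < p → blockPerm b p i = i := fun i =>
      blockPerm_of_lt hpb hb2
    constructor
    · rintro ⟨hzt, hzs, hz⟩ i hi hip heq
      by_cases hlt : i < p
      · rw [c3 i hlt] at heq
        exact hz i hi hlt heq
      · obtain rfl | rfl : i = p ∨ i = p + 1 := by omega
        · rw [c1] at heq
          rcases hst with ⟨h1, h2⟩ | ⟨h1, h2⟩
          · exact hzs (Fin.ext (heq.symm.trans h1))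
          · exact hzt (Fin.ext (heq.symm.trans h1))
        · rw [c2] at heq
          rcases hst with ⟨h1, h2⟩ | ⟨h1, h2⟩
          · exact hzt (Fin.ext (heq.symm.trans h2))
          · exact hzs (Fin.ext (heq.symm.trans h2))
    · intro hz
      have hzp := hz p hr (by omega)
      have hzq := hz (p + 1) (by omega) (by omega)
      rw [c1] at hzp
      rw [c2] at hzq
      refine ⟨?_, ?_, fun i hi hip => ?_⟩
      · rintro rfl
        rcases hst with ⟨h1, h2⟩ | ⟨h1, h2⟩
        · exact hzq h2
        · exact hzp h1
      · rintro rfl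
        rcases hst with ⟨h1, h2⟩ | ⟨h1, h2⟩
        · exact hzp h1
        · exact hzq h2
      · have := hz i hi (by omega)
        rwa [c3 i hip] at this

end

/-! ### The program -/

section Programs

open RAM.Expr

/-- Enumerate the objects in the array. -/
def fillLoop : Program :=
  .loop (.lt (var 4) (var 0))
    (.seq (.store (addr (var 4)) (var 4)) (.store (.const 4) (.add (var 4) (.const 1))))

/-- Search the positions from `j` to `r` for the object that is nearest to the end of the chain. -/
def nearestLoop (o : Objective) : Program :=
  .loop (.lt (var 4) (var 1))
    (.seq (.ite (pairTest o (entry (.sub (var 2) (.const 1))) (entry (var 4))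
        (entry (.sub (var 2) (.const 1))) (entry (var 3)))
      (.store (.const 3) (var 4)) .skip)
    (.store (.const 4) (.add (var 4) (.const 1))))

/-- Start a chain if there is none, and prepare the search for a nearest neighbour. -/
def chainStart : Program :=
  .seq (.ite (.eq (var 2) (.const 0)) (.store (.const 2) (.const 1)) .skip)
    (.seq (.ite (.eq (var 2) (.const 1)) (.store (.const 3) (var 2))
      (.store (.const 3) (.sub (var 2) (.const 2))))
    (.store (.const 4) (var 2)))

/-- Match the last two objects of the chain. -/
def chainMatch : Program :=
  .seq (swapEntries (.sub (var 2) (.const 1)) (.sub (var 1) (.const 1)))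
    (.seq (swapEntries (.sub (var 2) (.const 2)) (.sub (var 1) (.const 2)))
    (.seq (.store (.const 1) (.sub (var 1) (.const 2)))
      (.store (.const 2) (.sub (var 2) (.const 2)))))

/-- Append the nearest neighbour to the chain. -/
def chainPush : Program :=
  .seq (swapEntries (var 2) (var 3)) (.store (.const 2) (.add (var 2) (.const 1)))

/-- The nearest neighbour chain algorithm. -/
def chainLoop (o : Objective) : Program :=
  .loop (.lt (.const 1) (var 1))
    (.seq chainStart (.seq (nearestLoop o) (.ite (.lt (var 3) (var 2)) chainMatch chainPush)))

/-- Search the pairs from position `j` on for the best one. -/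
def bestLoop (o : Objective) : Program :=
  .loop (.lt (var 4) (var 0))
    (.seq (.ite (pairTest o (entry (var 4)) (entry (.add (var 4) (.const 1)))
        (entry (var 3)) (entry (.add (var 3) (.const 1))))
      (.store (.const 3) (var 4)) .skip)
    (.store (.const 4) (.add (var 4) (.const 2))))

/-- Write the pair at the current position in its better orientation. -/
def emitPair (o : Objective) : Program :=
  .ite (prefTest o (entry (var 2)) (entry (.add (var 2) (.const 1)))
      (entry (.add (var 2) (.const 1))) (entry (var 2)))
    (.emit (entry (var 2)) (entry (.add (var 2) (.const 1))))
    (.emit (entry (.add (var 2) (.const 1))) (entry (var 2)))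

/-- Move the best pair to the current position, write it, and go to the next position. -/
def sortSelect (o : Objective) : Program :=
  .seq (swapEntries (var 3) (var 2))
    (.seq (swapEntries (.add (var 3) (.const 1)) (.add (var 2) (.const 1)))
    (.seq (emitPair o) (.store (.const 2) (.add (var 2) (.const 2)))))

/-- Prepare the search for the best pair. -/
def sortStart : Program :=
  .seq (.store (.const 3) (var 2)) (.store (.const 4) (.add (var 2) (.const 2)))

/-- Write the matched pairs in sorted order. -/
def sortLoop (o : Objective) : Program :=
  .loop (.lt (var 2) (var 0)) (.seq sortStart (.seq (bestLoop o) (sortSelect o)))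

/-- Greedy matching by nearest neighbour chains. -/
def greedyProgram (o : Objective) : Program :=
  .seq fillLoop (.seq (.store (.const 1) (var 0)) (.seq (chainLoop o)
    (.seq (.store (.const 2) (var 1)) (sortLoop o))))

end Programs

/-! ### Correctness and running time of the program -/

section Correctness

variable {n : ℕ} {D F : Type*} [LinearOrder D] [LinearOrder F] {o : Objective}
  {d : Fin n → Fin n → D} {e : ℕ → ℕ → F} {w r k b j t : ℕ} {A : ℕ → ℕ} {out : List (ℕ × ℕ)}

theorem fillLoop_runs (hw : n + 9 ≤ 2 ^ w) :
    Runs d (n + 6) w fillLoop ⟨layout n 0 0 0 0 0 (fun _ => 0), out⟩ (n * 19 + 6) (fun σ =>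
      ∃ j A, σ = ⟨layout n 0 0 0 j 0 A, out⟩ ∧ Enumerates n A) := by
  have h := Runs.loop (d := d) (S := n + 6) (w := w) (b := .lt (.var 4) (.var 0)) (C := 13)
    (P := .seq (.store (.addr (.var 4)) (.var 4)) (.store (.const 4) (.add (.var 4) (.const 1))))
    (σ := ⟨layout n 0 0 0 0 0 (fun _ => 0), out⟩)
    (fun σ => ∃ j A, σ = ⟨layout n 0 0 0 j 0 A, out⟩ ∧ j ≤ n ∧ ∀ i < j, A i = i)
    (fun σ => n - σ.mem 4) ?_ ?_ ⟨0, fun _ => 0, rfl, Nat.zero_le _, by simp⟩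
  · refine h.mono (by simp [Test.cost, Expr.cost]) ?_
    rintro σ ⟨⟨j, A, rfl, hj, hA⟩, hb⟩
    obtain rfl : j = n := by
      simp only [Test.Holds, Expr.eval, layout_four, layout_zero] at hb
      omega
    refine ⟨j, A, rfl, ?_, ?_⟩
    · intro i hi
      rwa [hA i hi]
    · intro i hi l hl h
      rwa [hA i hi, hA l hl] at h
  · rintro σ ⟨j, A, rfl, hj, hA⟩
    simp only [Test.Legal, Expr.Legal, Expr.eval, layout_four, layout_zero]
    omega
  · rintro σ ⟨j, A, rfl, hj, hA⟩ hb
    simp only [Test.Holds, Expr.eval, layout_four, layout_zero] at hb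
    refine (Runs.of_wp ?_).mono (by simp [Program.straightCost, Expr.cost]) fun _ h => h
    simp only [wp, Expr.Legal, Expr.eval, layout_four, update_layout_four, update_layout_add]
    refine ⟨by omega, by omega, by omega, by omega, by omega, by omega,
      ⟨j + 1, _, rfl, by omega, ?_⟩, by omega⟩
    intro i hi
    by_cases hij : i = j
    · simp [hij]
    · rw [Function.update_of_ne hij]
      exact hA i (by omega)

/-- The initial candidate is the predecessor, at `k - 2`. A chain of one object has none, and
position `1` serves instead; it is unmatched because `2 ≤ r`. -/
theorem nearestLoop_runs (he : IsKey o d e) (hw : n + 9 ≤ 2 ^ w) (hA : Enumerates n A)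
    (hk : 1 ≤ k) (hkr : k ≤ r) (hr : r ≤ n) (hr2 : 2 ≤ r)
    (hb : b = if k = 1 then k else k - 2) :
    Runs d (n + 6) w (nearestLoop o) ⟨layout n r k b k t A, out⟩ (n * 200 + 200) (fun σ =>
      ∃ b j, σ = ⟨layout n r k b j t A, out⟩ ∧ (b + 2 = k ∨ k ≤ b ∧ b < r) ∧
      ∀ x, k ≤ x ∨ x + 2 = k → x < r →
        pairKey e (A (k - 1)) (A b) ≤ pairKey e (A (k - 1)) (A x)) := by
  have h := Runs.loop (d := d) (S := n + 6) (w := w) (b := .lt (.var 4) (.var 1)) (C := 180)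
    (P := .seq (.ite (pairTest o (.entry (.sub (.var 2) (.const 1))) (.entry (.var 4))
        (.entry (.sub (.var 2) (.const 1))) (.entry (.var 3)))
      (.store (.const 3) (.var 4)) .skip)
    (.store (.const 4) (.add (.var 4) (.const 1))))
    (σ := ⟨layout n r k b k t A, out⟩)
    (fun σ => ∃ b j, σ = ⟨layout n r k b j t A, out⟩ ∧ k ≤ j ∧ j ≤ r ∧
      (b + 2 = k ∨ k ≤ b ∧ b < r) ∧ ∀ x, k ≤ x ∨ x + 2 = k → x < j →
        pairKey e (A (k - 1)) (A b) ≤ pairKey e (A (k - 1)) (A x))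
    (fun σ => r - σ.mem 4) ?_ ?_ ⟨b, k, rfl, le_rfl, hkr, by split_ifs at hb <;> omega, ?_⟩
  · refine h.mono ?_ ?_
    · simp only [layout_four, Test.cost, Expr.cost]
      omega
    · rintro σ ⟨⟨b, j, rfl, hkj, hjr, hbk, hmin⟩, hb⟩
      simp only [Test.Holds, Expr.eval, layout_four, layout_one] at hb
      exact ⟨b, j, rfl, hbk, fun x hx hxr => hmin x hx (by omega)⟩
  · rintro σ ⟨b, j, rfl, hkj, hjr, hbk, hmin⟩
    simp only [Test.Legal, Expr.Legal, Expr.eval, layout_four, layout_one]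
    omega
  · rintro σ ⟨b, j, rfl, hkj, hjr, hbk, hmin⟩ hb
    simp only [Test.Holds, Expr.eval, layout_four, layout_one] at hb
    have h1 := hA.lt (k - 1) (by omega)
    have h2 := hA.lt j (by omega)
    have h3 := hA.lt b (by omega)
    refine (Runs.of_wp ?_).mono ?_ fun _ h => h
    · simp only [wp]
      refine ⟨?_, fun hle => ?_, fun hle => ?_⟩
      · apply pairTest_legal <;>
          simp only [Expr.Legal, Expr.eval, layout_two, layout_three, layout_four, layout_add] <;>
          omega
      · rw [pairTest_holds he] at hle <;>
          simp only [Expr.eval, layout_two, layout_three, layout_four, layout_add] at hle ⊢ <;>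
          try omega
        simp only [Expr.Legal, Expr.eval, layout_four, update_layout_four, update_layout_three]
        refine ⟨by omega, by omega, by omega, by omega, by omega, by omega,
          ⟨j, j + 1, rfl, by omega, by omega, by omega, ?_⟩, by omega⟩
        intro x hx hxj
        by_cases hxj' : x = j
        · rw [hxj']
        · exact hle.trans (hmin x hx (by omega))
      · rw [pairTest_holds he] at hle <;>
          simp only [Expr.eval, layout_two, layout_three, layout_four, layout_add] at hle ⊢ <;>
          try omega
        simp only [Expr.Legal, Expr.eval, layout_four, update_layout_four]
        refine ⟨by omega, by omega, by omega,
          ⟨b, j + 1, rfl, by omega, by omega, by omega, ?_⟩, by omega⟩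
        intro x hx hxj
        by_cases hxj' : x = j
        · rw [hxj']
          exact (not_le.1 hle).le
        · exact hmin x hx (by omega)
    · cases o <;> decide
  · intro x hx hxk
    have : x = b := by split_ifs at hb <;> omega
    rw [this]

/-- The potential `2 * r - k` drops by one when an object joins the chain and by two when a pair is
matched; starting a new chain only lowers it further. -/
theorem chainLoop_body_runs (he : IsKey o d e) (hw : n + 9 ≤ 2 ^ w) (h : ChainInv e n r k A)
    (hr : 1 < r) (ht : t < n + 9) :
    Runs d (n + 6) w (.seq chainStart (.seq (nearestLoop o)
      (.ite (.lt (.var 3) (.var 2)) chainMatch chainPush)))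
      ⟨layout n r k b j t A, out⟩ (n * 200 + 400) (fun σ =>
      ∃ r' k' b j t A, σ = ⟨layout n r' k' b j t A, out⟩ ∧ ChainInv e n r' k' A ∧
        t < n + 9 ∧ 2 * r' - k' < 2 * r - k) := by
  have hrn := h.r_le
  have hkr := h.k_le
  refine (Runs.seq (T := 40) (T' := n * 200 + 360) ((Runs.of_wp (Q := fun σ =>
    ∃ k', 1 ≤ k' ∧ k ≤ k' ∧ ChainInv e n r k' A ∧
      σ = ⟨layout n r k' (if k' = 1 then k' else k' - 2) k' t A, out⟩) ?_).mono (by decide)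
      ?_)).mono (by omega) fun _ h => h
  · simp only [chainStart, wp, Test.Legal, Test.Holds, Expr.Legal, Expr.eval, layout_two,
      update_layout_two, update_layout_three, update_layout_four]
    refine ⟨by omega, fun h0 => ?_, fun h0 => ?_⟩
    · subst h0
      refine ⟨by omega, by omega, by omega, by omega, fun _ => ?_, fun h => absurd trivial h⟩
      refine ⟨by omega, by omega, by omega, by omega, by omega, by omega, 1, le_rfl,
        Nat.zero_le _, h.start hr, by simp⟩
    · refine ⟨by omega, fun h1 => ?_, fun h1 => ?_⟩
      · refine ⟨by omega, by omega, by omega, by omega, by omega, by omega, k, by omega, le_rfl,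
          h, by simp [h1]⟩
      · refine ⟨by omega, by omega, by omega, by omega, by omega, by omega, k, by omega, le_rfl,
          h, by simp [h1]⟩
  · rintro σ ⟨k', hk', hkk, h, rfl⟩
    have hkr := h.k_le
    refine (Runs.seq (T := n * 200 + 200) (T' := 160) ((nearestLoop_runs he hw h.enum hk' h.k_le hrn
      hr rfl).mono le_rfl ?_)).mono (by omega) fun _ h => h
    rintro σ ⟨b, j, rfl, hbk, hmin⟩
    refine (Runs.of_wp ?_).mono (by decide) fun _ h => h
    simp only [wp]
    refine ⟨?_, fun hlt => ?_, fun hlt => ?_⟩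
    · simp only [Test.Legal, Expr.Legal, Expr.eval, layout_two, layout_three]
      omega
    · simp only [Test.Holds, Expr.eval, layout_two, layout_three] at hlt
      -- The only candidate inside the chain is the predecessor, so the last two objects are nearest
      -- to each other.
      obtain rfl : b = k' - 2 := by omega
      have hm := h.match (by omega) hmin
      have h2 := h.enum.swap (x := k' - 1) (y := r - 1) (by omega) (by omega)
      refine wp_swapEntries hw h.enum.lt (x := k' - 1) (y := r - 1) ?_ ?_ ?_ ?_ (by omega)
        (by omega) ht fun t ht => ?_
      any_goals
        intros
        simp only [Expr.Legal, Expr.eval, layout_one, layout_two]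
        try omega
      refine wp_swapEntries hw h2.lt (x := k' - 2) (y := r - 2) ?_ ?_ ?_ ?_ (by omega)
        (by omega) ht fun t ht => ?_
      any_goals
        intros
        simp only [Expr.Legal, Expr.eval, layout_one, layout_two]
        try omega
      simp only [wp, Expr.Legal, Expr.eval, layout_one, layout_two, update_layout_one,
        update_layout_two]
      exact ⟨by omega, by omega, by omega, by omega, by omega, by omega,
        r - 2, k' - 2, k' - 2, j, t, _, rfl, hm, ht, by omega⟩
    · simp only [Test.Holds, Expr.eval, layout_two, layout_three] at hlt
      have hm := h.push hk' (by omega) (by omega) hmin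
      refine wp_swapEntries hw h.enum.lt (x := k') (y := b) ?_ ?_ ?_ ?_ (by omega)
        (by omega) ht fun t ht => ?_
      any_goals
        intros
        simp only [Expr.Legal, Expr.eval, layout_two, layout_three]
        try omega
      simp only [wp, Expr.Legal, Expr.eval, layout_two, update_layout_two]
      exact ⟨by omega, by omega, by omega,
        r, k' + 1, b, j, t, _, rfl, hm, ht, by omega⟩

theorem chainLoop_runs (he : IsKey o d e) (hw : n + 9 ≤ 2 ^ w) (h : ChainInv e n n 0 A) :
    Runs d (n + 6) w (chainLoop o) ⟨layout n n 0 0 j 0 A, out⟩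
      (2 * n * (5 + (n * 200 + 400)) + 5) (fun σ =>
      ∃ r k b j t A, σ = ⟨layout n r k b j t A, out⟩ ∧ SortInv e n r r A ∧
        t < n + 9) := by
  have h := Runs.loop (d := d) (S := n + 6) (w := w) (b := .lt (.const 1) (.var 1))
    (C := n * 200 + 400)
    (P := .seq chainStart (.seq (nearestLoop o)
      (.ite (.lt (.var 3) (.var 2)) chainMatch chainPush)))
    (σ := ⟨layout n n 0 0 j 0 A, out⟩)
    (fun σ => ∃ r k b j t A, σ = ⟨layout n r k b j t A, out⟩ ∧ ChainInv e n r k A ∧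
      t < n + 9)
    (fun σ => 2 * σ.mem 1 - σ.mem 2) ?_ ?_
    ⟨n, 0, 0, j, 0, A, rfl, h, by omega⟩
  · refine h.mono (by simp [Test.cost, Expr.cost]) ?_
    rintro σ ⟨⟨r, k, b, j, t, A, rfl, h, ht⟩, hlt⟩
    simp only [Test.Holds, Expr.eval, layout_one] at hlt
    exact ⟨r, k, b, j, t, A, rfl, h.sortInv (by omega), ht⟩
  · rintro σ ⟨r, k, b, j, t, A, rfl, h, ht⟩
    have := h.r_le
    simp only [Test.Legal, Expr.Legal, Expr.eval, layout_one]
    omega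
  · rintro σ ⟨r, k, b, j, t, A, rfl, h, ht⟩ hlt
    simp only [Test.Holds, Expr.eval, layout_one] at hlt
    refine (chainLoop_body_runs he hw h hlt ht).mono le_rfl ?_
    rintro σ ⟨r', k', b, j, t, A, rfl, h, ht, hlt⟩
    exact ⟨⟨r', k', b, j, t, A, rfl, h, ht⟩, hlt⟩

theorem bestLoop_runs (he : IsKey o d e) (hw : n + 9 ≤ 2 ^ w) (hA : Enumerates n A)
    (hk : k + 1 < n) (hkn : k % 2 = n % 2) :
    Runs d (n + 6) w (bestLoop o) ⟨layout n r k k (k + 2) t A, out⟩ (n * 200 + 200) (fun σ =>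
      ∃ b j, σ = ⟨layout n r k b j t A, out⟩ ∧ k ≤ b ∧ b + 1 < n ∧ b % 2 = k % 2 ∧
      ∀ i, k ≤ i → i % 2 = k % 2 → i + 1 < n →
        pairKey e (A b) (A (b + 1)) ≤ pairKey e (A i) (A (i + 1))) := by
  have h := Runs.loop (d := d) (S := n + 6) (w := w) (b := .lt (.var 4) (.var 0)) (C := 180)
    (P := .seq (.ite (pairTest o (.entry (.var 4)) (.entry (.add (.var 4) (.const 1)))
        (.entry (.var 3)) (.entry (.add (.var 3) (.const 1))))
      (.store (.const 3) (.var 4)) .skip)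
    (.store (.const 4) (.add (.var 4) (.const 2))))
    (σ := ⟨layout n r k k (k + 2) t A, out⟩)
    (fun σ => ∃ b j, σ = ⟨layout n r k b j t A, out⟩ ∧ k ≤ j ∧ j ≤ n ∧ j % 2 = n % 2 ∧ k ≤ b ∧
      b + 1 < n ∧ b % 2 = k % 2 ∧ ∀ i, k ≤ i → i % 2 = k % 2 → i < j →
        pairKey e (A b) (A (b + 1)) ≤ pairKey e (A i) (A (i + 1)))
    (fun σ => n - σ.mem 4) ?_ ?_
    ⟨k, k + 2, rfl, by omega, by omega, by omega, le_rfl, hk, rfl, ?_⟩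
  · refine h.mono ?_ ?_
    · simp only [layout_four, Test.cost, Expr.cost]
      omega
    · rintro σ ⟨⟨b, j, rfl, hkj, hjn, hj2, hkb, hbn, hb2, hmin⟩, hb⟩
      simp only [Test.Holds, Expr.eval, layout_four, layout_zero] at hb
      exact ⟨b, j, rfl, hkb, hbn, hb2, fun i hi hi2 hin => hmin i hi hi2 (by omega)⟩
  · rintro σ ⟨b, j, rfl, hkj, hjn, hj2, hkb, hbn, hb2, hmin⟩
    simp only [Test.Legal, Expr.Legal, Expr.eval, layout_four, layout_zero]
    omega
  · rintro σ ⟨b, j, rfl, hkj, hjn, hj2, hkb, hbn, hb2, hmin⟩ hb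
    simp only [Test.Holds, Expr.eval, layout_four, layout_zero] at hb
    have h1 := hA.lt j (by omega)
    -- Equal parity of `j` and `n` turns `j < n` into `j + 1 < n`.
    have h2 := hA.lt (j + 1) (by omega)
    have h3 := hA.lt b (by omega)
    have h4 := hA.lt (b + 1) (by omega)
    refine (Runs.of_wp ?_).mono ?_ fun _ h => h
    · simp only [wp]
      refine ⟨?_, fun hle => ?_, fun hle => ?_⟩
      · apply pairTest_legal <;>
          simp only [Expr.Legal, Expr.eval, layout_three, layout_four, layout_add] <;> omega
      · rw [pairTest_holds he] at hle <;>
          simp only [Expr.eval, layout_three, layout_four, layout_add] at hle ⊢ <;>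
          try omega
        simp only [Expr.Legal, Expr.eval, layout_four, update_layout_four, update_layout_three]
        refine ⟨by omega, by omega, by omega, by omega, by omega, by omega,
          ⟨j, j + 2, rfl, by omega, by omega, by omega, by omega, by omega, by omega, ?_⟩, by omega⟩
        intro x hx hx2 hxj
        by_cases hxj' : x = j
        · rw [hxj']
        · exact hle.trans (hmin x hx hx2 (by omega))
      · rw [pairTest_holds he] at hle <;>
          simp only [Expr.eval, layout_three, layout_four, layout_add] at hle ⊢ <;>
          try omega
        simp only [Expr.Legal, Expr.eval, layout_four, update_layout_four]
        refine ⟨by omega, by omega, by omega,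
          ⟨b, j + 2, rfl, by omega, by omega, by omega, by omega, by omega, by omega, ?_⟩, by omega⟩
        intro x hx hx2 hxj
        by_cases hxj' : x = j
        · rw [hxj']
          exact (not_le.1 hle).le
        · exact hmin x hx hx2 (by omega)
    · cases o <;> decide
  · intro x hx hx2 hxk
    obtain rfl : x = k := by omega
    exact le_rfl

/-- What remains to be done completes the output `out` to a greedy matching. -/
def Completes (o : Objective) (d : Fin n → Fin n → D) (R : Finset (Fin n))
    (out : List (ℕ × ℕ)) : Prop :=
  ∃ M : List (Fin n × Fin n), out = M.map (fun p => ((p.1 : ℕ), (p.2 : ℕ))) ∧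
    ∀ M', IsGreedyMatching o d R M' → IsGreedyMatching o d Finset.univ (M ++ M')

/-- The output grows at its end, whereas `IsGreedyMatching` is built from its front. Hence the
invariant `Completes`, which quantifies over all continuations. -/
theorem sortLoop_body_runs (he : IsKey o d e) (hw : n + 9 ≤ 2 ^ w) (h : SortInv e n r k A)
    (hc : Completes o d (remaining r k A) out) (hk : k < n)
    (ht : t < n + 9) :
    Runs d (n + 6) w (.seq sortStart (.seq (bestLoop o) (sortSelect o)))
      ⟨layout n r k b j t A, out⟩ (n * 200 + 400) (fun σ =>
      ∃ k' b j t A out, σ = ⟨layout n r k' b j t A, out⟩ ∧ SortInv e n r k' A ∧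
        Completes o d (remaining r k' A) out ∧
        t < n + 9 ∧ n - k' < n - k) := by
  have hk1 : k + 1 < n := by have := h.parity; omega
  refine (Runs.seq (T := 20) (T' := n * 200 + 380) ((Runs.of_wp (Q := fun σ =>
    σ = ⟨layout n r k k (k + 2) t A, out⟩) ?_).mono (by decide) ?_)).mono (by omega) fun _ h => h
  · simp only [sortStart, wp, Expr.Legal, Expr.eval, layout_two, update_layout_three,
      update_layout_four, and_true]
    omega
  rintro σ rfl
  refine (Runs.seq (T := n * 200 + 200) (T' := 180) ((bestLoop_runs he hw h.enum hk1
    h.parity).mono le_rfl ?_)).mono (by omega) fun _ h => h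
  rintro σ ⟨b, j, rfl, hkb, hbn, hb2, hmin⟩
  refine (Runs.of_wp ?_).mono (by cases o <;> decide) fun _ h => h
  have h2 := h.enum.swap (x := b) (y := k) (by omega) (by omega)
  have hstep := h.step hkb hb2 hbn
  have hlt := hstep.enum.lt
  have hAk : (A ∘ blockPerm b k) k = A b := by simp [blockPerm_self hkb hb2]
  have hAk1 : (A ∘ blockPerm b k) (k + 1) = A (b + 1) := by simp [blockPerm_self_succ hb2]
  have l1 := h.enum.lt b (by omega)
  have l2 := h.enum.lt (b + 1) hbn
  refine wp_swapEntries hw h.enum.lt (x := b) (y := k) ?_ ?_ ?_ ?_ (by omega)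
    (by omega) ht fun t ht => ?_
  any_goals
    intros
    simp only [Expr.Legal, Expr.eval, layout_three, layout_two]
    try omega
  refine wp_swapEntries hw h2.lt (x := b + 1) (y := k + 1) ?_ ?_ ?_ ?_ (by omega)
    (by omega) ht fun t ht => ?_
  any_goals
    intros
    simp only [Expr.Legal, Expr.eval, layout_three, layout_two]
    try omega
  rw [show (A ∘ Equiv.swap b k) ∘ Equiv.swap (b + 1) (k + 1) = A ∘ blockPerm b k from rfl]
  have hfin : ∀ s t : Fin n, (A b = s ∧ A (b + 1) = t ∨ A b = t ∧ A (b + 1) = s) → e s t ≤ e t s →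
      Completes o d (remaining r (k + 2) (A ∘ blockPerm b k)) (out ++ [((s : ℕ), (t : ℕ))]) := by
    intro s t hst hle
    obtain ⟨M, rfl, hM⟩ := hc
    refine ⟨M ++ [(s, t)], by simp, fun M' hM' => ?_⟩
    rw [List.append_assoc]
    exact hM _ (h.select he hkb hb2 hbn hmin hst hle hM')
  simp only [wp, emitPair]
  refine ⟨?_, fun hle => ?_, fun hle => ?_⟩
  · apply prefTest_legal <;>
      simp only [Expr.Legal, Expr.eval, layout_two, layout_add, hAk, hAk1] <;> omega
  · rw [prefTest_holds he] at hle <;>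
      simp only [Expr.eval, layout_two, layout_add, hAk, hAk1] at hle ⊢ <;> try omega
    simp only [Expr.Legal, Expr.eval, layout_two, layout_add, update_layout_two, hAk, hAk1]
    exact ⟨by omega, by omega, by omega, by omega, by omega, k + 2, b, j, t, _, _, rfl, hstep,
      hfin ⟨A b, l1⟩ ⟨A (b + 1), l2⟩ (.inl ⟨rfl, rfl⟩) hle, ht, by omega⟩
  · rw [prefTest_holds he] at hle <;>
      simp only [Expr.eval, layout_two, layout_add, hAk, hAk1] at hle ⊢ <;> try omega
    simp only [Expr.Legal, Expr.eval, layout_two, layout_add, update_layout_two, hAk, hAk1]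
    exact ⟨by omega, by omega, by omega, by omega, by omega, k + 2, b, j, t, _, _, rfl, hstep,
      hfin ⟨A (b + 1), l2⟩ ⟨A b, l1⟩ (.inr ⟨rfl, rfl⟩) (not_le.1 hle).le, ht,
      by omega⟩

theorem sortLoop_runs (he : IsKey o d e) (hw : n + 9 ≤ 2 ^ w) (h : SortInv e n r r A)
    (ht : t < n + 9) :
    Runs d (n + 6) w (sortLoop o) ⟨layout n r r b j t A, []⟩
      (n * (6 + (n * 200 + 400)) + 6) (fun σ => ∃ M : List (Fin n × Fin n),
        σ.out = M.map (fun p => ((p.1 : ℕ), (p.2 : ℕ))) ∧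
        IsGreedyMatching o d Finset.univ M) := by
  have h := Runs.loop (d := d) (S := n + 6) (w := w) (b := .lt (.var 2) (.var 0))
    (C := n * 200 + 400) (P := .seq sortStart (.seq (bestLoop o) (sortSelect o)))
    (σ := ⟨layout n r r b j t A, []⟩)
    (fun σ => ∃ k b j t A out, σ = ⟨layout n r k b j t A, out⟩ ∧ SortInv e n r k A ∧
      Completes o d (remaining r k A) out ∧ t < n + 9)
    (fun σ => n - σ.mem 2) ?_ ?_
    ⟨r, b, j, t, A, [], rfl, h, ⟨[], rfl, fun M' hM' => ?_⟩, ht⟩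
  · refine h.mono ?_ ?_
    · simp only [layout_two, Test.cost, Expr.cost]
      gcongr; omega
    · rintro σ ⟨⟨k, b, j, t, A, out, rfl, h, hc, ht⟩, hlt⟩
      simp only [Test.Holds, Expr.eval, layout_two, layout_zero] at hlt
      obtain rfl : k = n := le_antisymm h.p_le (by omega)
      obtain ⟨M, rfl, hM⟩ := hc
      exact ⟨M, rfl, by simpa using hM [] h.done⟩
  · rintro σ ⟨k, b, j, t, A, out, rfl, h, hc, ht⟩
    have := h.p_le
    simp only [Test.Legal, Expr.Legal, Expr.eval, layout_two, layout_zero]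
    omega
  · rintro σ ⟨k, b, j, t, A, out, rfl, h, hc, ht⟩ hlt
    simp only [Test.Holds, Expr.eval, layout_two, layout_zero] at hlt
    refine (sortLoop_body_runs he hw h hc hlt ht).mono le_rfl ?_
    rintro σ ⟨k', b, j, t, A, out, rfl, h, hc, ht, hlt⟩
    exact ⟨⟨k', b, j, t, A, out, rfl, h, hc, ht⟩, hlt⟩
  · rw [List.nil_append]
    convert hM'
    ext x
    simp only [remaining, Finset.mem_filter, Finset.mem_univ, true_and, true_iff]
    intro i hi hi'
    omega

theorem greedyProgram_runs (he : IsKey o d e) (hw : n + 9 ≤ 2 ^ w) :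
    Runs d (n + 6) w (greedyProgram o) (State.init n) (600 * n ^ 2 + 1300 * n + 40) (fun σ =>
      ∃ M : List (Fin n × Fin n), σ.out = M.map (fun p => ((p.1 : ℕ), (p.2 : ℕ))) ∧
        IsGreedyMatching o d Finset.univ M) := by
  have hinit : State.init n = ⟨layout n 0 0 0 0 0 (fun _ => 0), []⟩ := by
    rw [← init_mem]; rfl
  rw [hinit, greedyProgram]
  refine (Runs.seq ((fillLoop_runs hw).mono le_rfl ?_) (T' := 4 +
    ((2 * n * (5 + (n * 200 + 400)) + 5) + (4 + (n * (6 + (n * 200 + 400)) + 6))))).mono ?_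
    fun _ h => h
  · rintro σ ⟨j, A, rfl, hA⟩
    refine Runs.seq ((Runs.of_wp (Q := fun σ => σ = ⟨layout n n 0 0 j 0 A, []⟩) ?_).mono
      (by decide) ?_)
    · simp only [wp, Expr.Legal, Expr.eval, layout_zero, update_layout_one, and_true]
      omega
    rintro σ rfl
    refine Runs.seq ((chainLoop_runs he hw ?_).mono le_rfl ?_)
    · exact ⟨hA, le_rfl, rfl, Nat.zero_le _, fun i hi => by omega,
        fun x hx y hy _ hV => by omega⟩
    rintro σ ⟨r, k, b, j, t, A, rfl, h, ht⟩
    have := h.r_le_p.trans h.p_le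
    refine Runs.seq ((Runs.of_wp (Q := fun σ => σ = ⟨layout n r r b j t A, []⟩) ?_).mono
      (by decide) ?_)
    · simp only [wp, Expr.Legal, Expr.eval, layout_one, update_layout_two, and_true]
      omega
    rintro σ rfl
    exact sortLoop_runs he hw h ht
  · ring_nf
    omega

theorem greedyProgram_performs (o : Objective) :
    PerformsGreedyMatching.{u} o (greedyProgram o) (fun n => 600 * n ^ 2 + 1300 * n + 40)
      (fun n => n + 6) (fun n => Nat.log 2 n + 5) := by
  intro n D _ d
  obtain ⟨F, _, e, he⟩ := exists_isKey o d
  -- From `n + 1 ≤ 2 ^ (Nat.log 2 n + 1)`, the four further bits give at least `16 * (n + 1)`.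
  have hw : n + 9 ≤ 2 ^ (Nat.log 2 n + 5) := by
    have := Nat.lt_pow_succ_log_self (b := 2) (by norm_num) n
    rw [pow_add]
    rw [pow_succ] at this
    omega
  obtain ⟨σ, t, hexec, ht, M, hout, hM⟩ := greedyProgram_runs he hw
  exact ⟨σ, t, M, hexec, ht, hout, hM⟩

end Correctness

/-! ### Asymptotic bounds -/

section Asymptotics

open Filter Asymptotics

theorem isBigO_time : (fun n : ℕ => ((600 * n ^ 2 + 1300 * n + 40 : ℕ) : ℝ)) =O[atTop]
    (fun n : ℕ => (n : ℝ) ^ 2) := by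
  -- For `n ≥ 1` the sum `600 + 1300 + 40` of the coefficients suffices.
  refine IsBigO.of_bound 1940 ?_
  filter_upwards [eventually_ge_atTop 1] with n hn
  have hn' : (1 : ℝ) ≤ n := by exact_mod_cast hn
  rw [Real.norm_of_nonneg (by positivity), Real.norm_of_nonneg (by positivity)]
  push_cast
  nlinarith

theorem isBigO_space : (fun n : ℕ => ((n + 6 : ℕ) : ℝ)) =O[atTop] (fun n : ℕ => (n : ℝ)) := by
  refine IsBigO.of_bound 7 ?_
  filter_upwards [eventually_ge_atTop 1] with n hn
  have hn' : (1 : ℝ) ≤ n := by exact_mod_cast hn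
  rw [Real.norm_of_nonneg (by positivity), Real.norm_of_nonneg (by positivity)]
  push_cast
  linarith

/-- Holds since `Real.exp 1 < 3`; it lets the logarithmic factors of the first time bound be added
for free. -/
theorem one_le_log {n : ℕ} (hn : 3 ≤ n) : 1 ≤ Real.log n := by
  rw [Real.le_log_iff_exp_le (by positivity)]
  have : (3 : ℝ) ≤ n := by exact_mod_cast hn
  linarith [Real.exp_one_lt_d9]

theorem isBigO_word : (fun n : ℕ => ((Nat.log 2 n + 5 : ℕ) : ℝ)) =O[atTop]
    (fun n : ℕ => Real.log n) := by
  refine IsBigO.of_bound 7 ?_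
  filter_upwards [eventually_ge_atTop 3] with n hn
  have h1 := one_le_log hn
  have h2 : (Nat.log 2 n : ℝ) ≤ Real.log n / Real.log 2 := Real.natLog_le_logb n 2
  have h3 : Real.log n / Real.log 2 ≤ 2 * Real.log n := by
    rw [div_le_iff₀ (Real.log_pos one_lt_two)]
    nlinarith [Real.log_two_gt_d9]
  rw [Real.norm_of_nonneg (by positivity), Real.norm_of_nonneg (by positivity)]
  push_cast
  linarith

theorem isBigO_sq_mul_log_sq : (fun n : ℕ => (n : ℝ) ^ 2) =O[atTop]
    (fun n : ℕ => (n : ℝ) ^ 2 * Real.log n ^ 2) := by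
  refine IsBigO.of_bound 1 ?_
  filter_upwards [eventually_ge_atTop 3] with n hn
  have h1 := one_le_log hn
  rw [Real.norm_of_nonneg (by positivity), Real.norm_of_nonneg (by positivity), one_mul]
  exact le_mul_of_one_le_right (by positivity) (one_le_pow₀ h1)

end Asymptotics

end RAM

theorem mainTheorem6 (o : Objective) :
    (∃ (P : RAM.Program) (T S w : ℕ → ℕ),
      RAM.PerformsGreedyMatching.{u} o P T S w ∧
      (fun n : ℕ => (T n : ℝ)) =O[Filter.atTop] (fun n : ℕ => (n : ℝ) ^ 2 * Real.log n ^ 2) ∧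
      (fun n : ℕ => (S n : ℝ)) =O[Filter.atTop] (fun n : ℕ => (n : ℝ)) ∧
      (fun n : ℕ => (w n : ℝ)) =O[Filter.atTop] (fun n : ℕ => Real.log n)) ∧
    (∃ (P : RAM.Program) (T S w : ℕ → ℕ),
      RAM.PerformsGreedyMatching.{u} o P T S w ∧
      (fun n : ℕ => (T n : ℝ)) =O[Filter.atTop] (fun n : ℕ => (n : ℝ) ^ 2) ∧
      (fun n : ℕ => (w n : ℝ)) =O[Filter.atTop] (fun n : ℕ => Real.log n)) :=
  ⟨⟨_, _, _, _, RAM.greedyProgram_performs o, RAM.isBigO_time.trans RAM.isBigO_sq_mul_log_sq,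
    RAM.isBigO_space, RAM.isBigO_word⟩,
    _, _, _, _, RAM.greedyProgram_performs o, RAM.isBigO_time, RAM.isBigO_word⟩
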